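/- Let $m\ge 5$ be odd, $N=3^m-1$ and $n=N/2=\frac{3^m-1}{2}$, and let $\beta$ be a primitive element of $\mathrm{GF}(3^m)$. For an integer $i$ with $0\le i\le N-1$ and $3$-adic expansion $i=\sum_{t=0}^{m-1} i_t3^t$, $i_t\in\{0,1,2\}$, put $\mathrm{wt}_3(i)=\sum_{t=0}^{m-1} i_t$, and let $\mathbb{M}_{\beta^i}(x)$ be the minimal polynomial of $\beta^i$ over $\mathrm{GF}(3)$. The $3$-cyclotomic coset of $i$ modulo $N$ is $\{i3^k \bmod N : k\ge 0\}\subseteq\{0,\dots,N-1\}$, and its smallest element is its coset leader; let $\Gamma^{(1)}$ be the set of odd coset leaders. For $j\in\{1,3\}$ let $$g_{(j,m)}(x)=\prod_{i\in\Gamma^{(1)},\ \mathrm{wt}_3(i)\equiv j \ (\mathrm{mod}\ 4)}\mathbb{M}_{\beta^i}(x)\in \mathrm{GF}(3)[x],$$ and let $\mathcal{C}_{(j,m)}\subseteq \mathrm{GF}(3)^n$ be the ternary negacyclic code of length $n$ generated by $g_{(j,m)}$, that is, the set of all $(c_0,\dots,c_{n-1})\in\mathrm{GF}(3)^n$ for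 which the class of $c_0+c_1x+\cdots+c_{n-1}x^{n-1}$ lies in the ideal generated by $g_{(j,m)}$ in $\mathrm{GF}(3)[x]/(x^n+1)$. Then $\mathcal{C}_{(1,m)}$ has dimension and minimum Hamming distance $$\dim \mathcal{C}_{(1,m)}=\frac{3^m-1+2(-1)^{\frac{m+1}{2}}}{4},\qquad d(\mathcal{C}_{(1,m)})\ge \frac{3^{\frac{m-1}{2}}+2+(-1)^{\frac{m-1}{2}}}{4}+3,$$ its dual code (with respect to the standard inner product on $\mathrm{GF}(3)^n$) is $\mathcal{C}_{(1,m)}^{\bot}=\mathcal{C}_{(3,m)}$, and $$\dim \mathcal{C}_{(1,m)}^{\bot}=\frac{3^m-1+2(-1)^{\frac{m-1}{2}}}{4},\qquad d(\mathcal{C}_{(1,m)}^{\bot})\ge \frac{3^{\frac{m-1}{2}}-(-1)^{\frac{m-1}{2}}}{4}+2 .$$ -/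

import Mathlib

open Polynomial

noncomputable section

namespace TernaryNegacyclic

/-! ### Linear codes: minimum distance and dual -/

/-- The minimum Hamming distance of a linear code `C ⊆ F^n`, i.e. the smallest Hamming distance
between two distinct codewords (and `0` when `C` has only one codeword). -/
def minDist {F : Type*} [Field F] [DecidableEq F] {n : ℕ} (C : Submodule F (Fin n → F)) : ℕ :=
  sInf {d : ℕ | ∃ x ∈ C, ∃ y ∈ C, x ≠ y ∧ hammingDist x y = d}

/-- The dual code `C^⊥ = {c : ∑ cᵢ bᵢ = 0 for all b ∈ C}`. -/
def dualCode {F : Type*} [Field F] {n : ℕ} (C : Submodule F (Fin n → F)) :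
    Submodule F (Fin n → F) where
  carrier := {c | ∀ b ∈ C, ∑ i, c i * b i = 0}
  zero_mem' := by
    intro b _
    simp
  add_mem' := by
    intro x y hx hy b hb
    have h1 : ∑ i, x i * b i = 0 := hx b hb
    have h2 : ∑ i, y i * b i = 0 := hy b hb
    simp [add_mul, Finset.sum_add_distrib, h1, h2]
  smul_mem' := by
    intro a x hx b hb
    have h1 : ∑ i, x i * b i = 0 := hx b hb
    simp [mul_assoc, ← Finset.mul_sum, h1]

/-! ### Negacyclic codes -/

/-- The map `Φ : F^n → F[x]/(x^n + 1)`,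
`(c₀, …, c_{n-1}) ↦ c₀ + c₁ x + ⋯ + c_{n-1} x^{n-1}`. -/
def codePoly (F : Type*) [Field F] (n : ℕ) :
    (Fin n → F) →ₗ[F] F[X] ⧸ Ideal.span {(X ^ n + 1 : F[X])} :=
  (Ideal.Quotient.mkₐ F (Ideal.span {(X ^ n + 1 : F[X])})).toLinearMap ∘ₗ
    ∑ i : Fin n, (monomial (i : ℕ)) ∘ₗ LinearMap.proj i

/-- The negacyclic code of length `n` over `F` generated by `g`: the set of all `c ∈ F^n` such that
`Φ c` lies in the principal ideal `(g)` of `F[x]/(x^n + 1)`. -/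
def negacyclicCode {F : Type*} [Field F] (n : ℕ) (g : F[X]) : Submodule F (Fin n → F) :=
  Submodule.comap (codePoly F n)
    ((Ideal.span {Ideal.Quotient.mk (Ideal.span {(X ^ n + 1 : F[X])}) g}).restrictScalars F)

/-! ### Cyclotomic cosets and the codes `C_(j,m)` -/

/-- The `q`-cyclotomic coset of `i` modulo `N`, as a set of residues in `{0, …, N-1}`. -/
def cyclotomicCoset (q N i : ℕ) : Set ℕ :=
  {j | ∃ k : ℕ, j = (i * q ^ k) % N}

open Classical in
/-- The set of odd `q`-cyclotomic coset leaders modulo `N`: the odd elements of `{0, …, N-1}`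
that are the smallest element of their coset. -/
def oddCosetLeaders (q N : ℕ) : Finset ℕ :=
  (Finset.range N).filter fun i => Odd i ∧ ∀ j ∈ cyclotomicCoset q N i, i ≤ j

/-- The `3`-weight of `i`: the sum of the digits of its `3`-adic expansion. -/
def wt3 (i : ℕ) : ℕ := (Nat.digits 3 i).sum

/-- The polynomial `g_(j,m)` over `GF(3)`: the product of the minimal polynomials of `β^i`, over
the odd `3`-cyclotomic coset leaders `i` modulo `3^m - 1` with `wt3 i ≡ j (mod 4)`. -/
def gPoly {K : Type*} [Field K] [Algebra (ZMod 3) K] (m : ℕ) (β : K) (j : ℕ) : (ZMod 3)[X] :=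
  ∏ i ∈ (oddCosetLeaders 3 (3 ^ m - 1)).filter (fun i => wt3 i ≡ j [MOD 4]),
    minpoly (ZMod 3) (β ^ i)

/-- The ternary negacyclic code `C_(j,m)` of length `(3^m - 1)/2` with generator polynomial
`g_(j,m)`. -/
def fourthCode {K : Type*} [Field K] [Algebra (ZMod 3) K] (m : ℕ) (β : K) (j : ℕ) :
    Submodule (ZMod 3) (Fin ((3 ^ m - 1) / 2) → ZMod 3) :=
  negacyclicCode ((3 ^ m - 1) / 2) (gPoly m β j)

end TernaryNegacyclic

end

/-!
A word, read as a polynomial, lies in `C_(j,m)` if and only if it vanishes at `β^i` for every `i`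
whose `3`-weight is congruent to `j` modulo `4`: multiplication by `3` modulo `3^m - 1` permutes the
`3`-adic digits cyclically, so these exponents form a union of cyclotomic cosets, and by Frobenius
descent the minimal polynomials over the coset leaders have exactly these zeros. They are odd
because `i` and its `3`-weight have the same parity.

By Parseval's identity on the odd powers of `β`, the dual of such a code has the zeros `β^i` with
`i` odd and `-i` outside the class. As `i` and `3^m - 1 - i` have `3`-weights adding up to `2m ≡ 2`
modulo `4`, this exchanges the classes of `1` and `3`, whose sizes are found by evaluating the
generating function of the `3`-weight at a primitive fourth root of unity.

For the minimum distances let `m = 2h + 1`. The exponent `3^(2h) + i(3^h + 1)` with `i < 3^h` has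
`3`-weight `1 + 2 wt3 i`, which is congruent to `1 + 2i` modulo `4`. Hence even `i` give consecutive
zeros of `C_(1,m)` and odd `i` of `C_(3,m)`, in steps of `2(3^h + 1)`, where `3^h + 1` is prime to
the length; the BCH argument (a Vandermonde determinant) applies.
-/

namespace TernaryNegacyclic

/-! ### Digit sums -/

section DigitSum

variable {b : ℕ}

lemma sum_digits_add_mul (hb : 1 < b) {r : ℕ} (hr : r < b) (q : ℕ) :
    (b.digits (r + b * q)).sum = r + (b.digits q).sum := by
  by_cases h : r ≠ 0 ∨ q ≠ 0
  · rw [Nat.digits_add b hb r q hr h, List.sum_cons]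
  · obtain ⟨rfl, rfl⟩ : r = 0 ∧ q = 0 := by tauto
    simp

lemma sum_digits_of_lt (hb : 1 < b) {r : ℕ} (hr : r < b) : (b.digits r).sum = r := by
  simpa using sum_digits_add_mul hb hr 0

lemma sum_digits_eq_mod_add_div (hb : 1 < b) (i : ℕ) :
    (b.digits i).sum = i % b + (b.digits (i / b)).sum := by
  rw [← sum_digits_add_mul hb (Nat.mod_lt i (by omega)), Nat.mod_add_div]

lemma sum_digits_add_pow_mul (hb : 1 < b) {k x : ℕ} (hx : x < b ^ k) (y : ℕ) :
    (b.digits (x + b ^ k * y)).sum = (b.digits x).sum + (b.digits y).sum := by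
  induction k generalizing x with
  | zero => simp_all
  | succ k ih =>
    have hdiv : x / b < b ^ k := Nat.div_lt_of_lt_mul (by rwa [← pow_succ'])
    have hsplit : x + b ^ (k + 1) * y = x % b + b * (x / b + b ^ k * y) := by
      conv_lhs => rw [← Nat.mod_add_div x b]
      ring
    rw [hsplit, sum_digits_add_mul hb (Nat.mod_lt x (by omega)), ih hdiv,
      sum_digits_eq_mod_add_div hb x, add_assoc]

lemma sum_digits_pow_sub_one_sub (hb : 1 < b) {m i : ℕ} (hi : i < b ^ m) :
    (b.digits (b ^ m - 1 - i)).sum + (b.digits i).sum = m * (b - 1) := by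
  induction m generalizing i with
  | zero => simp_all
  | succ m ih =>
    have hdiv : i / b < b ^ m := Nat.div_lt_of_lt_mul (by rwa [← pow_succ'])
    have hmod : i % b < b := Nat.mod_lt i (by omega)
    have hsplit : b ^ (m + 1) - 1 - i = b - 1 - i % b + b * (b ^ m - 1 - i / b) := by
      have hle : b * (i / b + 1) ≤ b * b ^ m := Nat.mul_le_mul_left b hdiv
      rw [mul_add, mul_one] at hle
      have hi' := Nat.mod_add_div i b
      rw [Nat.sub_sub (b ^ m), Nat.mul_sub, mul_add, mul_one, pow_succ']
      omega
    rw [hsplit, sum_digits_add_mul hb (by omega), sum_digits_eq_mod_add_div hb i, Nat.succ_mul,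
      ← ih hdiv]
    omega

/-- Multiplication by `b` modulo `b ^ m - 1` rotates the `m` digits. -/
lemma sum_digits_mul_mod_pow_sub_one (hb : 1 < b) {m i : ℕ} (hi : i < b ^ m - 1) :
    (b.digits (i * b % (b ^ m - 1))).sum = (b.digits i).sum := by
  obtain _ | k := m
  · simp at hi
  have hpos : 0 < b ^ k := by positivity
  obtain ⟨r, hr, d, rfl⟩ : ∃ r < b ^ k, ∃ d, i = r + b ^ k * d :=
    ⟨i % b ^ k, Nat.mod_lt i hpos, i / b ^ k, (Nat.mod_add_div i _).symm⟩
  rw [pow_succ] at hi ⊢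
  have hd : d < b := lt_of_mul_lt_mul_left (by omega : b ^ k * d < b ^ k * b) (Nat.zero_le _)
  have hrot : (r + b ^ k * d) * b = d + b * r + (b ^ k * b - 1) * d := by
    zify [show 1 ≤ b ^ k * b by omega]
    ring
  have hlt : d + b * r < b ^ k * b - 1 := by
    have hr_mul : b * (r + 1) ≤ b * b ^ k := Nat.mul_le_mul_left b hr
    rw [mul_add, mul_one, mul_comm b (b ^ k)] at hr_mul
    by_contra! hle
    have hd_top : d + 1 = b := by omega
    have hr_top : r + 1 = b ^ k := by
      refine Nat.eq_of_mul_eq_mul_left (show 0 < b by omega) ?_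
      rw [mul_add, mul_one, mul_comm b (b ^ k)]
      omega
    have htop : b ^ k * d + b ^ k = b ^ k * b := by rw [← hd_top, mul_add, mul_one]
    omega
  rw [hrot, Nat.add_mul_mod_self_left, Nat.mod_eq_of_lt hlt, sum_digits_add_mul hb hd,
    sum_digits_add_pow_mul hb hr, sum_digits_of_lt hb hd, add_comm]

lemma sum_pow_sum_digits {R : Type*} [CommSemiring R] (hb : 1 < b) (z : R) (m : ℕ) :
    ∑ i ∈ Finset.range (b ^ m), z ^ (b.digits i).sum = (∑ r ∈ Finset.range b, z ^ r) ^ m := by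
  induction m with
  | zero => simp
  | succ m ih =>
    have hblocks : ∀ d ≤ b, ∑ i ∈ Finset.range (b ^ m * d), z ^ (b.digits i).sum
        = (∑ i ∈ Finset.range (b ^ m), z ^ (b.digits i).sum) * ∑ r ∈ Finset.range d, z ^ r := by
      intro d hd
      induction d with
      | zero => simp
      | succ d ihd =>
        rw [mul_add, mul_one, Finset.sum_range_add, ihd (by omega), Finset.sum_range_succ, mul_add,
          Finset.sum_mul _ _ (z ^ d)]
        congr 1
        refine Finset.sum_congr rfl fun x hx => ?_
        rw [add_comm, sum_digits_add_pow_mul hb (Finset.mem_range.1 hx), sum_digits_of_lt hb hd,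
          pow_add]
    rw [pow_succ b, hblocks b le_rfl, ih, pow_succ]

end DigitSum

/-! ### The BCH bound -/

lemma eq_zero_of_sum_mul_pow_eq_zero {ι R : Type*} [CommRing R] [IsDomain R] {S : Finset ι}
    {v x : ι → R} (hx : Set.InjOn x S) (h : ∀ t < S.card, ∑ i ∈ S, v i * x i ^ t = 0) :
    ∀ i ∈ S, v i = 0 := by
  intro i hi
  have hinj : Function.Injective fun k => x (S.equivFin.symm k) := fun k l hkl =>
    S.equivFin.symm.injective (Subtype.ext (hx (S.equivFin.symm k).2 (S.equivFin.symm l).2 hkl))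
  have hv : (fun k => v (S.equivFin.symm k)) = 0 := by
    refine Matrix.eq_zero_of_forall_pow_sum_mul_pow_eq_zero hinj fun t => ?_
    rw [← h t t.2, ← Finset.sum_coe_sort S fun i => v i * x i ^ (t : ℕ)]
    exact Equiv.sum_comp S.equivFin.symm fun i : S => v i * x i ^ (t : ℕ)
  simpa using congrFun hv (S.equivFin ⟨i, hi⟩)

section Words

variable {F K : Type*} [Field F] [Field K] [Algebra F K] {n : ℕ}

/-- The polynomial `c₀ + c₁ x + ⋯ + c_{n-1} x^{n-1}` of a word `c`, that is, `codePoly` before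
passing to the quotient by `x^n + 1`. -/
noncomputable def wordPoly : (Fin n → F) →ₗ[F] F[X] :=
  ∑ i : Fin n, (monomial (i : ℕ)) ∘ₗ LinearMap.proj i

lemma wordPoly_apply (c : Fin n → F) : wordPoly c = ∑ i : Fin n, monomial (i : ℕ) (c i) := by
  simp [wordPoly]

lemma aeval_wordPoly (c : Fin n → F) (z : K) :
    aeval z (wordPoly c) = ∑ k : Fin n, algebraMap F K (c k) * z ^ (k : ℕ) := by
  simp [wordPoly_apply, aeval_monomial]

lemma exists_wordPoly_eq {p : F[X]} (hp : p.degree < n) : ∃ c : Fin n → F, wordPoly c = p := by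
  refine ⟨fun i => p.coeff i, ?_⟩
  rw [wordPoly_apply, Fin.sum_univ_eq_sum_range fun i => monomial i (p.coeff i)]
  ext i
  simp only [finsetSum_coeff, coeff_monomial, Finset.sum_ite_eq', Finset.mem_range]
  split_ifs with hi
  · rfl
  · exact (coeff_eq_zero_of_degree_lt (hp.trans_le (by exact_mod_cast not_lt.1 hi))).symm

lemma lt_hammingNorm_of_aeval_eq_zero [DecidableEq F] {c : Fin n → F} (hc : c ≠ 0) {δ : ℕ}
    {x y : K} (hx : IsPrimitiveRoot x n) (hy : y ≠ 0)
    (h : ∀ t < δ, aeval (y * x ^ t) (wordPoly c) = 0) : δ < hammingNorm c := by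
  by_contra! hle
  have hinj : Set.InjOn (fun i : Fin n => x ^ (i : ℕ)) {i | c i ≠ 0} :=
    fun i _ j _ hij => Fin.ext (hx.pow_inj i.2 j.2 hij)
  have hv := eq_zero_of_sum_mul_pow_eq_zero (S := {i | c i ≠ 0})
    (v := fun i => algebraMap F K (c i) * y ^ (i : ℕ)) (by simpa using hinj) fun t ht => by
      rw [← h t (ht.trans_le hle), aeval_wordPoly, Finset.sum_filter]
      refine Finset.sum_congr rfl fun k _ => ?_
      split_ifs with hk
      · rw [mul_pow, pow_right_comm, mul_assoc]
      · rw [not_not.1 hk, map_zero, zero_mul]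
  refine hc (funext fun i => by_contra fun hi => ?_)
  exact mul_ne_zero ((_root_.map_ne_zero _).2 hi) (pow_ne_zero _ hy) (hv i (by simpa using hi))

lemma lt_minDist [DecidableEq F] {C : Submodule F (Fin n → F)} (hC : C ≠ ⊥) {δ : ℕ}
    (h : ∀ c ∈ C, c ≠ 0 → δ < hammingNorm c) : δ < minDist C := by
  obtain ⟨c, hc, hc0⟩ := C.exists_mem_ne_zero_of_ne_bot hC
  unfold minDist
  refine Nat.lt_of_succ_le (le_csInf ⟨_, c, hc, 0, C.zero_mem, hc0, rfl⟩ ?_)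
  rintro _ ⟨x, hx, y, hy, hxy, rfl⟩
  rw [hammingDist_eq_hammingNorm, neg_add_eq_sub]
  exact h _ (C.sub_mem hy hx) (sub_ne_zero.2 hxy.symm)

/-! ### Negacyclic codes and their duals -/

lemma finrank_add_finrank_dualCode (C : Submodule F (Fin n → F)) :
    Module.finrank F C + Module.finrank F (dualCode C) = n := by
  let B : LinearMap.BilinForm F (Fin n → F) := dotProductBilin F F
  have hker : LinearMap.ker B = ⊥ :=
    LinearMap.ker_eq_bot'.2 fun x hx => dotProduct_eq_zero x fun y => LinearMap.congr_fun hx y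
  have horth : dualCode C = B.orthogonal C := by
    ext x
    change (∀ b ∈ C, x ⬝ᵥ b = 0) ↔ ∀ b ∈ C, b ⬝ᵥ x = 0
    simp only [dotProduct_comm]
  have hB := LinearMap.BilinForm.finrank_add_finrank_orthogonal' (B := B) C
  rwa [hker, inf_bot_eq, finrank_bot, add_zero, ← horth, Module.finrank_fin_fun] at hB

lemma mem_negacyclicCode_iff_dvd {g : F[X]} (hg : g ∣ X ^ n + 1) {c : Fin n → F} :
    c ∈ negacyclicCode n g ↔ g ∣ wordPoly c := by
  change Ideal.Quotient.mk _ (wordPoly c) ∈ Ideal.span _ ↔ _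
  rw [Ideal.mem_span_singleton]
  refine ⟨?_, map_dvd _⟩
  rintro ⟨q, hq⟩
  obtain ⟨q, rfl⟩ := Ideal.Quotient.mk_surjective q
  rw [← map_mul, Ideal.Quotient.eq, Ideal.mem_span_singleton] at hq
  exact (dvd_sub_left (dvd_mul_right g q)).1 (hg.trans hq)

lemma finrank_negacyclicCode_add_natDegree (hn : n ≠ 0) {g : F[X]} (hg : g ∣ X ^ n + 1) :
    Module.finrank F (negacyclicCode n g) + g.natDegree = n := by
  have hdeg : (X ^ n + 1 : F[X]).degree = n := degree_X_pow_add_C (Nat.pos_of_ne_zero hn) 1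
  have hne : (X ^ n + 1 : F[X]) ≠ 0 := X_pow_add_C_ne_zero (Nat.pos_of_ne_zero hn) 1
  have hg0 : g ≠ 0 := ne_zero_of_dvd_ne_zero hne hg
  let T : (Fin n → F) →ₗ[F] AdjoinRoot g := (AdjoinRoot.mkₐ g).toLinearMap ∘ₗ wordPoly
  have hker : LinearMap.ker T = negacyclicCode n g := by
    ext c
    rw [mem_negacyclicCode_iff_dvd hg, LinearMap.mem_ker, ← AdjoinRoot.mk_eq_zero]
    rfl
  have hrange : LinearMap.range T = ⊤ := by
    refine LinearMap.range_eq_top.2 fun a => ?_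
    obtain ⟨f, rfl⟩ := AdjoinRoot.mk_surjective a
    obtain ⟨c, hc⟩ := exists_wordPoly_eq (n := n)
      ((EuclideanDomain.mod_lt f hg0).trans_le (hdeg ▸ degree_le_of_dvd hg hne))
    refine ⟨c, ?_⟩
    change AdjoinRoot.mk g (wordPoly c) = AdjoinRoot.mk g f
    rw [hc, AdjoinRoot.mk_eq_mk, EuclideanDomain.mod_eq_sub_mul_div, sub_sub_cancel_left]
    exact (dvd_mul_right g _).neg_right
  have hrank := LinearMap.finrank_range_add_finrank_ker T
  rwa [hker, hrange, finrank_top, (AdjoinRoot.powerBasis hg0).finrank, AdjoinRoot.powerBasis_dim,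
    Module.finrank_fin_fun, add_comm] at hrank

lemma sum_pow_mul_inv_pow {x y : K} (hx : IsPrimitiveRoot x n) (hy : y ≠ 0) (k l : Fin n) :
    ∑ s ∈ Finset.range n, (y * x ^ s) ^ (k : ℕ) * (y * x ^ s)⁻¹ ^ (l : ℕ)
      = if k = l then (n : K) else 0 := by
  have hx0 : x ≠ 0 := hx.ne_zero k.pos.ne'
  split_ifs with hkl
  · subst hkl
    have hone : ∀ s, (y * x ^ s) ^ (k : ℕ) * (y * x ^ s)⁻¹ ^ (k : ℕ) = 1 := fun s => by
      rw [← mul_pow, mul_inv_cancel₀ (mul_ne_zero hy (pow_ne_zero s hx0)), one_pow]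
    simp only [hone, Finset.sum_const, Finset.card_range, nsmul_eq_mul, mul_one]
  · set z : K := x ^ (k : ℕ) / x ^ (l : ℕ)
    have hz : z ≠ 1 := fun hz => hkl <| Fin.ext <| hx.pow_inj k.2 l.2 <|
      (div_eq_one_iff_eq (pow_ne_zero _ hx0)).1 hz
    have hzn : z ^ n = 1 := by
      rw [div_pow, pow_right_comm x k, pow_right_comm x l, hx.pow_eq_one, one_pow, one_pow, div_one]
    have hterm : ∀ s, (y * x ^ s) ^ (k : ℕ) * (y * x ^ s)⁻¹ ^ (l : ℕ)
        = y ^ (k : ℕ) / y ^ (l : ℕ) * z ^ s := fun s => by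
      simp only [z]
      rw [inv_pow, ← div_eq_mul_inv, mul_pow, mul_pow, div_pow, pow_right_comm x s,
        pow_right_comm x s, mul_div_mul_comm]
    simp_rw [hterm]
    rw [← Finset.mul_sum, geom_sum_eq hz, hzn, sub_self, zero_div, mul_zero]

/-- Parseval's identity for the discrete Fourier transform along the coset `y⟨x⟩`. -/
lemma sum_aeval_mul_aeval_inv {x y : K} (hx : IsPrimitiveRoot x n) (hy : y ≠ 0)
    (b c : Fin n → F) :
    ∑ s ∈ Finset.range n, aeval (y * x ^ s) (wordPoly b) * aeval (y * x ^ s)⁻¹ (wordPoly c)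
      = n * algebraMap F K (∑ k, b k * c k) := by
  calc _ = ∑ k, ∑ l, algebraMap F K (b k) * algebraMap F K (c l) *
        ∑ s ∈ Finset.range n, (y * x ^ s) ^ (k : ℕ) * (y * x ^ s)⁻¹ ^ (l : ℕ) := by
        simp_rw [aeval_wordPoly, Finset.sum_mul_sum, Finset.mul_sum]
        rw [Finset.sum_comm]
        refine Finset.sum_congr rfl fun k _ => ?_
        rw [Finset.sum_comm]
        exact Finset.sum_congr rfl fun l _ => Finset.sum_congr rfl fun s _ => by ring
    _ = n * algebraMap F K (∑ k, b k * c k) := by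
        simp_rw [sum_pow_mul_inv_pow hx hy, mul_ite, mul_zero, Finset.sum_ite_eq,
          Finset.mem_univ, if_true, map_sum, map_mul, Finset.mul_sum, mul_comm]

end Words

/-! ### Cyclotomic cosets and Frobenius orbits -/

section Frobenius

variable {F K : Type*} [Field F] [Fintype F] [Field K] [Algebra F K]

lemma mem_range_algebraMap_of_pow_card_eq {x : K} (hx : x ^ Fintype.card F = x) :
    x ∈ Set.range (algebraMap F K) := by
  have hsplits : (X ^ Fintype.card F - X : F[X]).Splits := by
    rw [splits_iff_card_roots, FiniteField.roots_X_pow_card_sub_X,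
      FiniteField.X_pow_card_sub_X_natDegree_eq F Fintype.one_lt_card]
    rfl
  have hne := FiniteField.X_pow_card_sub_X_ne_zero K (Fintype.one_lt_card (α := F))
  have hroot : x ∈ ((X ^ Fintype.card F - X : F[X]).map (algebraMap F K)).roots := by
    simpa [mem_roots hne, sub_eq_zero] using hx
  obtain ⟨a, -, ha⟩ := Multiset.mem_map.1 (hsplits.roots_map (algebraMap F K) ▸ hroot)
  exact ⟨a, ha⟩

lemma aeval_pow_card_pow (f : F[X]) (z : K) (k : ℕ) :
    aeval (z ^ Fintype.card F ^ k) f = aeval z f ^ Fintype.card F ^ k := by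
  induction k with
  | zero => simp
  | succ k ih =>
    rw [pow_succ, pow_mul, pow_mul, ← ih, ← map_pow, ← FiniteField.expand_card, expand_aeval]

lemma exists_map_eq_prod_X_sub_C {T : Finset K}
    (hT : ∀ x ∈ T, x ^ Fintype.card F ∈ T) :
    ∃ p : F[X], p.map (algebraMap F K) = ∏ x ∈ T, (X - C x) := by
  classical
  let φ : K →+* K := (FiniteField.frobeniusAlgHom F K).toRingHom
  have himage : T.image φ = T :=
    Finset.eq_of_subset_of_card_le (Finset.image_subset_iff.2 hT)
      (Finset.card_image_of_injective T φ.injective).ge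
  have hfix : (∏ x ∈ T, (X - C x)).map φ = ∏ x ∈ T, (X - C x) := by
    rw [Polynomial.map_prod]
    conv_rhs => rw [← himage, Finset.prod_image φ.injective.injOn]
    simp
  refine (mem_lifts _).1 ((lifts_iff_coeff_lifts _).2 fun k => ?_)
  refine mem_range_algebraMap_of_pow_card_eq ?_
  conv_rhs => rw [← hfix, coeff_map]
  rfl

lemma exists_eq_pow_of_aeval_minpoly_eq_zero {x y : K} (hy : IsIntegral F y)
    (hx : aeval x (minpoly F y) = 0) : ∃ k : ℕ, x = y ^ Fintype.card F ^ k := by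
  classical
  have hfinite : (Set.range fun k : ℕ => y ^ Fintype.card F ^ k).Finite := by
    refine ((minpoly F y).rootSet_finite K).subset ?_
    rintro _ ⟨k, rfl⟩
    refine (mem_rootSet_of_ne (minpoly.ne_zero hy)).2 ?_
    rw [aeval_pow_card_pow, minpoly.aeval, zero_pow (pow_pos Fintype.card_pos k).ne']
  obtain ⟨p, hp⟩ := exists_map_eq_prod_X_sub_C (F := F) (T := hfinite.toFinset) <| by
    simp only [Set.Finite.mem_toFinset]
    rintro _ ⟨k, rfl⟩
    exact ⟨k + 1, by simp only [pow_succ, pow_mul]⟩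
  have hroot : ∀ z, aeval z p = 0 ↔ z ∈ Set.range fun k : ℕ => y ^ Fintype.card F ^ k := fun z => by
    simp [← eval_map_algebraMap, hp, eval_prod, Finset.prod_eq_zero_iff, sub_eq_zero]
  obtain ⟨k, hk⟩ := (hroot x).1 <|
    aeval_eq_zero_of_dvd_aeval_eq_zero (minpoly.dvd F y ((hroot y).2 ⟨0, by simp⟩)) hx
  exact ⟨k, hk.symm⟩

end Frobenius

lemma mem_oddCosetLeaders {q N i : ℕ} :
    i ∈ oddCosetLeaders q N ↔ i < N ∧ Odd i ∧ ∀ j ∈ cyclotomicCoset q N i, i ≤ j := by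
  simp [oddCosetLeaders]

/-- `S` is a union of `q`-cyclotomic cosets modulo `N` which consist of odd residues, represented
in `{0, …, N - 1}`. -/
structure IsOddCosetUnion (q N : ℕ) (S : Finset ℕ) : Prop where
  lt : ∀ i ∈ S, i < N
  odd : ∀ i ∈ S, Odd i
  mul_mod_mem_iff : ∀ i < N, i * q % N ∈ S ↔ i ∈ S

namespace IsOddCosetUnion

variable {q N i : ℕ} {S : Finset ℕ}

lemma mul_pow_mod_mem (hS : IsOddCosetUnion q N S) (hi : i ∈ S) (k : ℕ) :
    i * q ^ k % N ∈ S := by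
  have hN := hS.lt i hi
  induction k with
  | zero => rwa [pow_zero, mul_one, Nat.mod_eq_of_lt hN]
  | succ k ih =>
    rwa [pow_succ, ← mul_assoc, ← Nat.mod_mul_mod, hS.mul_mod_mem_iff _ (Nat.mod_lt _ (by omega))]

lemma exists_mul_pow_mod_mem_oddCosetLeaders (hS : IsOddCosetUnion q N S) (hi : i ∈ S) :
    ∃ k : ℕ, i * q ^ k % N ∈ S ∩ oddCosetLeaders q N := by
  classical
  have hcoset : ∃ l, l ∈ cyclotomicCoset q N i := ⟨_, 0, rfl⟩
  obtain ⟨k, hk⟩ := Nat.find_spec hcoset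
  have hmem := hS.mul_pow_mod_mem hi k
  refine ⟨k, Finset.mem_inter.2 ⟨hmem, mem_oddCosetLeaders.2 ⟨hS.lt _ hmem, hS.odd _ hmem, ?_⟩⟩⟩
  rintro _ ⟨l, rfl⟩
  rw [← hk]
  refine Nat.find_min' hcoset ⟨k + l, ?_⟩
  rw [hk, Nat.mod_mul_mod, pow_add, mul_assoc]

end IsOddCosetUnion

/-- The exponents `i` for which `β^i` is a zero of the dual of the negacyclic code of length `n`
whose zeros are the `β^s`, `s ∈ S`: the odd `i` such that `-i ∉ S` modulo `2n`. -/
def dualZeros (n : ℕ) (S : Finset ℕ) : Finset ℕ :=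
  {i ∈ Finset.range (2 * n) | Odd i ∧ 2 * n - i ∉ S}

lemma mem_dualZeros {n i : ℕ} {S : Finset ℕ} :
    i ∈ dualZeros n S ↔ i < 2 * n ∧ Odd i ∧ 2 * n - i ∉ S := by
  simp [dualZeros]

lemma card_filter_odd_range_two_mul (n : ℕ) :
    ((Finset.range (2 * n)).filter Odd).card = n := by
  conv_rhs => rw [← Finset.card_range n]
  refine Finset.card_nbij' (· / 2) (2 * · + 1) ?_ ?_ ?_ ?_ <;>
    simp only [Finset.coe_filter, Finset.coe_range, Set.MapsTo, Set.LeftInvOn, Set.mem_ofPred_eq,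
      Finset.mem_range, Set.mem_Iio, Nat.odd_iff] <;> omega

lemma IsOddCosetUnion.card_add_card_dualZeros {q n : ℕ} {S : Finset ℕ}
    (hS : IsOddCosetUnion q (2 * n) S) : S.card + (dualZeros n S).card = n := by
  have hsubset : S ⊆ (Finset.range (2 * n)).filter Odd := fun i hi =>
    Finset.mem_filter.2 ⟨Finset.mem_range.2 (hS.lt i hi), hS.odd i hi⟩
  have hneg : (dualZeros n S).card = (((Finset.range (2 * n)).filter Odd) \ S).card := by
    refine Finset.card_nbij' (2 * n - ·) (2 * n - ·) ?_ ?_ ?_ ?_ <;> intro i hi <;>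
      simp only [Finset.mem_coe, mem_dualZeros, Finset.mem_sdiff, Finset.mem_filter,
        Finset.mem_range, Nat.odd_iff] at hi ⊢
    · exact ⟨by omega, hi.2.2⟩
    · exact ⟨by omega, by omega, by rw [Nat.sub_sub_self (by omega)]; exact hi.2⟩
    all_goals omega
  rw [hneg, Finset.card_sdiff_of_subset hsubset, card_filter_odd_range_two_mul]
  have hle := Finset.card_le_card hsubset
  rw [card_filter_odd_range_two_mul] at hle
  omega

lemma IsOddCosetUnion.card_lt {q n i : ℕ} {S : Finset ℕ} (hS : IsOddCosetUnion q (2 * n) S)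
    (hi : i < 2 * n) (hodd : Odd i) (hiS : i ∉ S) : S.card < n := by
  rw [← hS.card_add_card_dualZeros, Nat.lt_add_right_iff_pos, Finset.card_pos]
  have := hodd.pos
  exact ⟨2 * n - i, mem_dualZeros.2 ⟨by omega, by rw [Nat.odd_iff] at *; omega,
    by rwa [Nat.sub_sub_self hi.le]⟩⟩

lemma sub_mul_mod {N i q : ℕ} (hiN : i ≤ N) (hi : i * q % N ≠ 0) :
    (N - i) * q % N = N - i * q % N := by
  have hsum : ((N - i) * q + i * q) % N = 0 := by
    rw [← add_mul, Nat.sub_add_cancel hiN, Nat.mul_mod_right]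
  by_cases hle : N ≤ (N - i) * q % N + i * q % N
  · have hcarry := Nat.add_mod_add_of_le_add_mod hle
    omega
  · have hcarry := Nat.add_mod_of_add_mod_lt (not_le.1 hle)
    omega

lemma IsOddCosetUnion.dualZeros {q n : ℕ} (hq : Odd q) {S : Finset ℕ}
    (hS : IsOddCosetUnion q (2 * n) S) : IsOddCosetUnion q (2 * n) (dualZeros n S) where
  lt i hi := (mem_dualZeros.1 hi).1
  odd i hi := (mem_dualZeros.1 hi).2.1
  mul_mod_mem_iff i hi := by
    have hodd : Odd (i * q % (2 * n)) ↔ Odd i := by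
      rw [Nat.odd_iff, Nat.mod_mul_right_mod, ← Nat.odd_iff, Nat.odd_mul, and_iff_left hq]
    rw [mem_dualZeros, mem_dualZeros, hodd]
    refine and_congr (iff_of_true (Nat.mod_lt _ (by omega)) hi) (and_congr_right fun hi_odd => ?_)
    rw [← sub_mul_mod hi.le (hodd.2 hi_odd).pos.ne', hS.mul_mod_mem_iff _ ?_]
    have := hi_odd.pos
    omega

section CosetCode

/-- The polynomial over `F` whose zeros are the `β^i`, `i ∈ S`, for a union `S` of odd cyclotomic
cosets modulo `N`: the product of the minimal polynomials of `β^i` over the coset leaders `i`. -/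
noncomputable def cosetGenerator (F : Type*) {K : Type*} [Field F] [Fintype F] [Field K]
    [Algebra F K] (N : ℕ) (β : K) (S : Finset ℕ) : F[X] :=
  ∏ i ∈ S ∩ oddCosetLeaders (Fintype.card F) N, minpoly F (β ^ i)

/-- The negacyclic code of length `n` over `F` whose zeros are the `β^i`, `i ∈ S`, where `β` has
order `2n`. -/
noncomputable def cosetCode (F : Type*) {K : Type*} [Field F] [Fintype F] [Field K]
    [Algebra F K] (n : ℕ) (β : K) (S : Finset ℕ) : Submodule F (Fin n → F) :=
  negacyclicCode n (cosetGenerator F (2 * n) β S)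

variable {F K : Type*} [Field F] [Fintype F] [Field K] [Algebra F K] {β : K} {n N : ℕ}
  {S : Finset ℕ}

lemma isCoprime_minpoly_of_mem_oddCosetLeaders (hβ : IsPrimitiveRoot β N) {a b : ℕ}
    (ha : a ∈ oddCosetLeaders (Fintype.card F) N) (hb : b ∈ oddCosetLeaders (Fintype.card F) N)
    (hab : a ≠ b) : IsCoprime (minpoly F (β ^ a)) (minpoly F (β ^ b)) := by
  have hle : ∀ {a b}, a ∈ oddCosetLeaders (Fintype.card F) N →
      b ∈ oddCosetLeaders (Fintype.card F) N → aeval (β ^ a) (minpoly F (β ^ b)) = 0 → b ≤ a := by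
    intro a b ha hb h
    rw [mem_oddCosetLeaders] at ha hb
    have hb_int : IsIntegral F (β ^ b) := (hβ.isIntegral (by omega)).tower_top.pow b
    obtain ⟨k, hk⟩ := exists_eq_pow_of_aeval_minpoly_eq_zero hb_int h
    refine hb.2.2 a ⟨k, hβ.pow_inj ha.1 (Nat.mod_lt _ (by omega)) ?_⟩
    rw [← pow_eq_pow_mod _ hβ.pow_eq_one, hk, pow_mul]
  have hN : 0 < N := (Nat.zero_le a).trans_lt (mem_oddCosetLeaders.1 ha).1
  have hirr : ∀ i, Irreducible (minpoly F (β ^ i)) := fun i =>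
    minpoly.irreducible ((hβ.isIntegral hN).tower_top.pow i)
  rw [(hirr a).coprime_iff_not_dvd]
  intro hdvd
  have hdvd' := (hirr a).dvd_symm (hirr b) hdvd
  exact hab (le_antisymm (hle hb ha (minpoly.dvd_iff.1 hdvd'))
    (hle ha hb (minpoly.dvd_iff.1 hdvd)))

lemma cosetGenerator_dvd_iff (hβ : IsPrimitiveRoot β N)
    (hS : IsOddCosetUnion (Fintype.card F) N S) {f : F[X]} :
    cosetGenerator F N β S ∣ f ↔ ∀ i ∈ S, aeval (β ^ i) f = 0 := by
  refine ⟨fun h i hi => ?_, fun h => Finset.prod_dvd_of_coprime ?_ fun i hi => ?_⟩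
  · obtain ⟨k, hk⟩ := hS.exists_mul_pow_mod_mem_oddCosetLeaders hi
    have hdvd := (Finset.dvd_prod_of_mem (fun i => minpoly F (β ^ i)) hk).trans h
    rw [minpoly.dvd_iff, ← pow_eq_pow_mod _ hβ.pow_eq_one, pow_mul, aeval_pow_card_pow] at hdvd
    exact pow_eq_zero_iff (pow_pos Fintype.card_pos k).ne' |>.1 hdvd
  · intro a ha b hb hab
    exact isCoprime_minpoly_of_mem_oddCosetLeaders hβ (Finset.mem_inter.1 ha).2
      (Finset.mem_inter.1 hb).2 hab
  · exact minpoly.dvd _ _ (h i (Finset.mem_inter.1 hi).1)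

lemma natDegree_cosetGenerator (hN : 0 < N) (hβ : IsPrimitiveRoot β N)
    (hS : IsOddCosetUnion (Fintype.card F) N S) :
    (cosetGenerator F N β S).natDegree = S.card := by
  classical
  have hinj : Set.InjOn (β ^ ·) S := fun a ha b hb => hβ.pow_inj (hS.lt a ha) (hS.lt b hb)
  have hmonic : (cosetGenerator F N β S).Monic :=
    monic_prod_of_monic _ _ fun i _ => minpoly.monic ((hβ.isIntegral hN).tower_top.pow i)
  obtain ⟨p, hp⟩ := exists_map_eq_prod_X_sub_C (F := F) (T := S.image (β ^ ·)) <| by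
    simp only [Finset.mem_image]
    rintro _ ⟨i, hi, rfl⟩
    refine ⟨_, hS.mul_pow_mod_mem hi 1, ?_⟩
    rw [← pow_eq_pow_mod _ hβ.pow_eq_one, pow_one, pow_mul]
  rw [Finset.prod_image hinj] at hp
  have hpdeg : p.natDegree = S.card := by
    rw [← natDegree_map (algebraMap F K), hp,
      natDegree_prod_of_monic _ _ fun i _ => monic_X_sub_C _]
    simp only [natDegree_X_sub_C, Finset.sum_const, smul_eq_mul, mul_one]
  have hp0 : p ≠ 0 := by
    rintro rfl
    exact Finset.prod_ne_zero_iff.2 (fun i _ => X_sub_C_ne_zero (β ^ i))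
      (hp.symm.trans (Polynomial.map_zero _))
  refine le_antisymm ?_ ?_
  · rw [← hpdeg]
    refine natDegree_le_of_dvd ((cosetGenerator_dvd_iff hβ hS).2 fun i hi => ?_) hp0
    rw [← eval_map_algebraMap, hp, eval_prod]
    exact Finset.prod_eq_zero hi (by simp)
  · rw [← natDegree_map (algebraMap F K), ← Finset.card_image_of_injOn hinj]
    refine card_le_degree_of_subset_roots fun z hz => ?_
    obtain ⟨i, hi, rfl⟩ := Finset.mem_image.1 hz
    rw [mem_roots (hmonic.map _).ne_zero, IsRoot.def, eval_map_algebraMap]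
    exact (cosetGenerator_dvd_iff hβ hS).1 dvd_rfl i hi

lemma cosetGenerator_dvd_X_pow_add_one (hn : n ≠ 0) (hβ : IsPrimitiveRoot β (2 * n))
    (hS : IsOddCosetUnion (Fintype.card F) (2 * n) S) :
    cosetGenerator F (2 * n) β S ∣ X ^ n + 1 := by
  have hhalf : β ^ n = -1 :=
    (hβ.pow (by omega) (mul_comm 2 n)).eq_neg_one_of_two_right
  refine (cosetGenerator_dvd_iff hβ hS).2 fun i hi => ?_
  rw [map_add, map_one, map_pow, aeval_X, pow_right_comm, hhalf, (hS.odd i hi).neg_one_pow,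
    neg_add_cancel]

lemma mem_cosetCode (hn : n ≠ 0) (hβ : IsPrimitiveRoot β (2 * n))
    (hS : IsOddCosetUnion (Fintype.card F) (2 * n) S) {c : Fin n → F} :
    c ∈ cosetCode F n β S ↔ ∀ i ∈ S, aeval (β ^ i) (wordPoly c) = 0 := by
  rw [cosetCode, mem_negacyclicCode_iff_dvd (cosetGenerator_dvd_X_pow_add_one hn hβ hS),
    cosetGenerator_dvd_iff hβ hS]

lemma finrank_cosetCode_add_card (hn : n ≠ 0) (hβ : IsPrimitiveRoot β (2 * n))
    (hS : IsOddCosetUnion (Fintype.card F) (2 * n) S) :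
    Module.finrank F (cosetCode F n β S) + S.card = n := by
  rw [← natDegree_cosetGenerator (by omega) hβ hS]
  exact finrank_negacyclicCode_add_natDegree hn (cosetGenerator_dvd_X_pow_add_one hn hβ hS)

lemma odd_card_of_isPrimitiveRoot_two_mul (hn : n ≠ 0) (hβ : IsPrimitiveRoot β (2 * n)) :
    Odd (Fintype.card F) := by
  have : NeZero (2 * n) := ⟨by omega⟩
  have h2n : ((2 * n : ℕ) : K) ≠ 0 := hβ.neZero'.out
  refine Nat.odd_iff.2 (FiniteField.odd_card_of_char_ne_two fun h2 => h2n ?_)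
  have h2F : (2 : F) = 0 := by
    simpa [h2] using ringChar.Nat.cast_ringChar (R := F)
  rw [Nat.cast_mul, Nat.cast_ofNat, ← map_ofNat (algebraMap F K), h2F, map_zero, zero_mul]

lemma cosetCode_dualZeros_le_dualCode (hn : n ≠ 0) (hβ : IsPrimitiveRoot β (2 * n))
    (hS : IsOddCosetUnion (Fintype.card F) (2 * n) S) :
    cosetCode F n β (dualZeros n S) ≤ dualCode (cosetCode F n β S) := by
  have hD := hS.dualZeros (odd_card_of_isPrimitiveRoot_two_mul hn hβ)
  have hβ0 : β ≠ 0 := hβ.ne_zero (by omega)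
  have hn0 : (n : K) ≠ 0 := by
    have : NeZero (2 * n) := ⟨by omega⟩
    exact right_ne_zero_of_mul (Nat.cast_mul (α := K) 2 n ▸ hβ.neZero'.out)
  intro c hc b hb
  rw [mem_cosetCode hn hβ hD] at hc
  rw [mem_cosetCode hn hβ hS] at hb
  have hvanish : ∀ s ∈ Finset.range n,
      aeval (β * (β ^ 2) ^ s) (wordPoly b) * aeval (β * (β ^ 2) ^ s)⁻¹ (wordPoly c) = 0 := by
    intro s hs
    rw [Finset.mem_range] at hs
    rw [← pow_mul, ← pow_succ']
    by_cases hi : 2 * s + 1 ∈ S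
    · rw [hb _ hi, zero_mul]
    · have hinv : (β ^ (2 * s + 1))⁻¹ = β ^ (2 * n - (2 * s + 1)) := by
        refine inv_eq_of_mul_eq_one_right ?_
        rw [← pow_add, Nat.add_sub_cancel' (by omega), hβ.pow_eq_one]
      have hmem : 2 * n - (2 * s + 1) ∈ dualZeros n S := mem_dualZeros.2
        ⟨by omega, Nat.odd_iff.2 (by omega), by rwa [Nat.sub_sub_self (by omega)]⟩
      rw [hinv, hc _ hmem, mul_zero]
  have hparseval := sum_aeval_mul_aeval_inv (hβ.pow (by omega) rfl) hβ0 b c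
  rw [Finset.sum_eq_zero hvanish, eq_comm, mul_eq_zero, or_iff_right hn0, map_eq_zero] at hparseval
  simpa only [mul_comm] using hparseval

lemma dualCode_cosetCode (hn : n ≠ 0) (hβ : IsPrimitiveRoot β (2 * n))
    (hS : IsOddCosetUnion (Fintype.card F) (2 * n) S) :
    dualCode (cosetCode F n β S) = cosetCode F n β (dualZeros n S) := by
  have hD := hS.dualZeros (odd_card_of_isPrimitiveRoot_two_mul hn hβ)
  refine (Submodule.eq_of_le_of_finrank_eq (cosetCode_dualZeros_le_dualCode hn hβ hS) ?_).symm
  have hdim := finrank_cosetCode_add_card hn hβ hS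
  have hdim_dual := finrank_cosetCode_add_card hn hβ hD
  have hdim_orth := finrank_add_finrank_dualCode (cosetCode F n β S)
  have hcard := hS.card_add_card_dualZeros
  omega

lemma lt_minDist_cosetCode [DecidableEq F] (hβ : IsPrimitiveRoot β (2 * n))
    (hS : IsOddCosetUnion (Fintype.card F) (2 * n) S) (hcard : S.card < n) {a u δ : ℕ}
    (hu : u.Coprime n) (hzeros : ∀ t < δ, (a + 2 * u * t) % (2 * n) ∈ S) :
    δ < minDist (cosetCode F n β S) := by
  have hn : n ≠ 0 := by omega
  have hβ0 : β ≠ 0 := hβ.ne_zero (by omega)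
  refine lt_minDist ?_ fun c hc hc0 => ?_
  · intro hbot
    have hdim := finrank_cosetCode_add_card hn hβ hS
    rw [hbot, finrank_bot] at hdim
    omega
  · refine lt_hammingNorm_of_aeval_eq_zero hc0 ((hβ.pow (by omega) rfl).pow_of_coprime u hu)
      (pow_ne_zero a hβ0) fun t ht => ?_
    rw [← pow_mul, ← pow_mul, ← pow_add, pow_eq_pow_mod _ hβ.pow_eq_one]
    exact (mem_cosetCode hn hβ hS).1 hc _ (mul_assoc 2 u t ▸ hzeros t ht)

end CosetCode

/-! ### The ternary codes `C_(j,m)` -/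

lemma two_mul_three_pow_sub_one_div_two (m : ℕ) : 2 * ((3 ^ m - 1) / 2) = 3 ^ m - 1 :=
  Nat.mul_div_cancel' (Nat.Odd.sub_odd (Odd.pow (by decide)) odd_one).two_dvd

lemma three_pow_sub_one_div_two_ne_zero {m : ℕ} (hm : m ≠ 0) : (3 ^ m - 1) / 2 ≠ 0 := by
  have hpow : 3 ^ 1 ≤ 3 ^ m := Nat.pow_le_pow_right (by decide) (Nat.pos_of_ne_zero hm)
  omega

lemma odd_wt3_iff {i : ℕ} : Odd (wt3 i) ↔ Odd i := by
  have hmod : i ≡ wt3 i [MOD 2] := Nat.modEq_digits_sum 2 3 rfl i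
  rw [Nat.odd_iff, Nat.odd_iff, hmod]

/-- The exponents below `3^m - 1` whose `3`-weight is congruent to `j` modulo `4`; for odd `j` these
are the exponents of the zeros of `g_(j,m)`. -/
def weightClass (m j : ℕ) : Finset ℕ :=
  {i ∈ Finset.range (3 ^ m - 1) | wt3 i ≡ j [MOD 4]}

lemma mem_weightClass {m j i : ℕ} : i ∈ weightClass m j ↔ i < 3 ^ m - 1 ∧ wt3 i ≡ j [MOD 4] := by
  simp [weightClass]

lemma isOddCosetUnion_weightClass (m : ℕ) {j : ℕ} (hj : Odd j) :
    IsOddCosetUnion (Fintype.card (ZMod 3)) (2 * ((3 ^ m - 1) / 2)) (weightClass m j) := by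
  rw [ZMod.card, two_mul_three_pow_sub_one_div_two]
  refine ⟨fun i hi => (mem_weightClass.1 hi).1, fun i hi => ?_, fun i hi => ?_⟩
  · have hmod : wt3 i ≡ j [MOD 4] := (mem_weightClass.1 hi).2
    rwa [← odd_wt3_iff, Nat.odd_iff, hmod.of_dvd (show 2 ∣ 4 by decide), ← Nat.odd_iff]
  · rw [mem_weightClass, mem_weightClass, wt3, sum_digits_mul_mod_pow_sub_one (by decide) hi, wt3]
    exact and_congr_left fun _ => iff_of_true (Nat.mod_lt _ (by omega)) hi

lemma dualZeros_weightClass_one {m : ℕ} (hm : Odd m) :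
    dualZeros ((3 ^ m - 1) / 2) (weightClass m 1) = weightClass m 3 := by
  ext i
  rw [mem_dualZeros, mem_weightClass, mem_weightClass, two_mul_three_pow_sub_one_div_two]
  refine and_congr_right fun hi => ?_
  have hsum : wt3 (3 ^ m - 1 - i) + wt3 i = m * 2 :=
    sum_digits_pow_sub_one_sub (by decide) (by omega)
  rw [← odd_wt3_iff]
  have hpos : i = 0 → wt3 i = 0 := by rintro rfl; simp [wt3]
  rw [Nat.odd_iff] at hm ⊢
  simp only [Nat.ModEq]
  omega

lemma card_weightClass_one_add_three {m : ℕ} (hm : Odd m) :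
    (weightClass m 1).card + (weightClass m 3).card = (3 ^ m - 1) / 2 := by
  rw [← (isOddCosetUnion_weightClass m odd_one).card_add_card_dualZeros,
    dualZeros_weightClass_one hm]

lemma im_I_pow (w : ℕ) : (Complex.I ^ w).im
    = (if w ≡ 1 [MOD 4] then 1 else 0) - (if w ≡ 3 [MOD 4] then 1 else 0) := by
  have hw : w % 4 = 0 ∨ w % 4 = 1 ∨ w % 4 = 2 ∨ w % 4 = 3 := by omega
  rw [Complex.I_pow_eq_pow_mod]
  rcases hw with hw | hw | hw | hw <;> simp [Nat.ModEq, hw, pow_succ]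

/-- This is the imaginary part of `∑ I ^ wt3 i = (1 + I + I ^ 2) ^ m = I ^ m`. -/
lemma card_weightClass_one_sub_three (h : ℕ) :
    ((weightClass (2 * h + 1) 1).card : ℤ) - (weightClass (2 * h + 1) 3).card = (-1) ^ h := by
  have hgen : ∑ i ∈ Finset.range (3 ^ (2 * h + 1)), Complex.I ^ wt3 i = (-1) ^ h * Complex.I := by
    have hsum : ∑ r ∈ Finset.range 3, Complex.I ^ r = Complex.I := by
      simp [Finset.sum_range_succ]
    have hdigits := sum_pow_sum_digits (b := 3) (by decide) Complex.I (2 * h + 1)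
    rwa [hsum, pow_succ Complex.I, pow_mul, Complex.I_sq] at hdigits
  have hlast : (Complex.I ^ wt3 (3 ^ (2 * h + 1) - 1)).im = 0 := by
    have hwt : wt3 (3 ^ (2 * h + 1) - 1) = (2 * h + 1) * 2 := by
      simpa [wt3] using sum_digits_pow_sub_one_sub (b := 3) (m := 2 * h + 1) (i := 0)
    rw [hwt, im_I_pow, if_neg, if_neg, sub_self] <;> rw [Nat.ModEq] <;> omega
  rw [← Nat.sub_add_cancel (Nat.one_le_pow (2 * h + 1) 3 (by decide)),
    Finset.sum_range_succ] at hgen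
  have him := congrArg Complex.im hgen
  rw [Complex.add_im, hlast, add_zero, Complex.im_sum] at him
  simp_rw [im_I_pow, Finset.sum_sub_distrib, Finset.sum_boole] at him
  have hsign : ((-1 : ℂ) ^ h * Complex.I).im = (-1 : ℝ) ^ h := by
    rw [show (-1 : ℂ) ^ h = ((-1 : ℝ) ^ h : ℝ) by push_cast; rfl, Complex.im_ofReal_mul,
      Complex.I_im, mul_one]
  rw [hsign] at him
  exact_mod_cast him

lemma card_weightClass_one_and_three (h : ℕ) :
    ((weightClass (2 * h + 1) 1).card : ℚ) = (3 ^ (2 * h + 1) - 1 + 2 * (-1) ^ h) / 4 ∧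
    ((weightClass (2 * h + 1) 3).card : ℚ) = (3 ^ (2 * h + 1) - 1 - 2 * (-1) ^ h) / 4 := by
  have hadd : (2 : ℚ) * ((weightClass (2 * h + 1) 1).card + (weightClass (2 * h + 1) 3).card)
      = 3 ^ (2 * h + 1) - 1 := by
    have hnat := two_mul_three_pow_sub_one_div_two (2 * h + 1)
    rw [← card_weightClass_one_add_three (odd_two_mul_add_one h)] at hnat
    have hcast := congrArg (Nat.cast (R := ℚ)) hnat
    rwa [Nat.cast_sub (Nat.one_le_pow _ _ (by decide)), Nat.cast_mul, Nat.cast_add, Nat.cast_pow,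
      Nat.cast_one, Nat.cast_ofNat, Nat.cast_ofNat] at hcast
  have hsub : ((weightClass (2 * h + 1) 1).card : ℚ) - (weightClass (2 * h + 1) 3).card
      = (-1) ^ h := by
    exact_mod_cast card_weightClass_one_sub_three h
  constructor <;> linarith

section FourthCode

variable {K : Type*} [Field K] [Algebra (ZMod 3) K] {m : ℕ} {β : K}

lemma fourthCode_eq_cosetCode (m : ℕ) (β : K) (j : ℕ) :
    fourthCode m β j = cosetCode (ZMod 3) ((3 ^ m - 1) / 2) β (weightClass m j) := by
  have hindex : (oddCosetLeaders 3 (3 ^ m - 1)).filter (fun i => wt3 i ≡ j [MOD 4])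
      = weightClass m j ∩ oddCosetLeaders 3 (3 ^ m - 1) := by
    ext i
    simp only [Finset.mem_filter, Finset.mem_inter, mem_weightClass, mem_oddCosetLeaders]
    tauto
  rw [fourthCode, gPoly, cosetCode, cosetGenerator, ZMod.card, two_mul_three_pow_sub_one_div_two,
    hindex]

lemma finrank_fourthCode_add_card (hm : m ≠ 0) (hβ : IsPrimitiveRoot β (3 ^ m - 1)) {j : ℕ}
    (hj : Odd j) :
    Module.finrank (ZMod 3) (fourthCode m β j) + (weightClass m j).card = (3 ^ m - 1) / 2 := by
  rw [← two_mul_three_pow_sub_one_div_two] at hβ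
  rw [fourthCode_eq_cosetCode]
  exact finrank_cosetCode_add_card (three_pow_sub_one_div_two_ne_zero hm) hβ
    (isOddCosetUnion_weightClass m hj)

lemma finrank_fourthCode_one (hm : Odd m) (hβ : IsPrimitiveRoot β (3 ^ m - 1)) :
    Module.finrank (ZMod 3) (fourthCode m β 1) = (weightClass m 3).card := by
  have hdim := finrank_fourthCode_add_card hm.pos.ne' hβ odd_one
  have hcard := card_weightClass_one_add_three hm
  omega

lemma finrank_fourthCode_three (hm : Odd m) (hβ : IsPrimitiveRoot β (3 ^ m - 1)) :
    Module.finrank (ZMod 3) (fourthCode m β 3) = (weightClass m 1).card := by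
  have hdim := finrank_fourthCode_add_card hm.pos.ne' hβ (show Odd 3 by decide)
  have hcard := card_weightClass_one_add_three hm
  omega

lemma dualCode_fourthCode_one (hm : Odd m) (hβ : IsPrimitiveRoot β (3 ^ m - 1)) :
    dualCode (fourthCode m β 1) = fourthCode m β 3 := by
  rw [← two_mul_three_pow_sub_one_div_two] at hβ
  rw [fourthCode_eq_cosetCode, fourthCode_eq_cosetCode,
    dualCode_cosetCode (three_pow_sub_one_div_two_ne_zero hm.pos.ne') hβ
      (isOddCosetUnion_weightClass m odd_one), dualZeros_weightClass_one hm]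

lemma coprime_three_pow_add_one (h : ℕ) :
    (3 ^ h + 1).Coprime ((3 ^ (2 * h + 1) - 1) / 2) := by
  obtain ⟨k, hk⟩ : Odd (3 ^ h) := Odd.pow (by decide)
  have hlength : (3 ^ (2 * h + 1) - 1) / 2 = 1 + (3 ^ h + 1) * (3 * k) := by
    have hpow : 3 ^ (2 * h + 1) = 2 * (1 + (3 ^ h + 1) * (3 * k)) + 1 := by
      rw [pow_succ, mul_comm 2 h, pow_mul, hk]
      ring
    omega
  rw [hlength, Nat.coprime_add_mul_left_right]
  exact Nat.coprime_one_right _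

lemma bch_exponent_mem_weightClass {h i : ℕ} (hi : i < 3 ^ h) :
    3 ^ (2 * h) + i * (3 ^ h + 1) ∈ weightClass (2 * h + 1) (1 + 2 * i) := by
  have hdigits : 3 ^ (2 * h) + i * (3 ^ h + 1) = i + 3 ^ h * (i + 3 ^ h * 1) := by ring
  rw [mem_weightClass, hdigits]
  constructor
  · have hpow : 3 ^ (2 * h + 1) = 3 * (3 ^ h * 3 ^ h) := by ring
    have hle : 3 ^ h * (i + 1) ≤ 3 ^ h * 3 ^ h := Nat.mul_le_mul_left _ hi
    rw [hpow, mul_add, mul_one]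
    have hpos : 0 < 3 ^ h := by positivity
    rw [mul_add, mul_one] at hle
    omega
  · have hwt : wt3 (i + 3 ^ h * (i + 3 ^ h * 1)) = wt3 i + (wt3 i + 1) := by
      simp only [wt3]
      rw [sum_digits_add_pow_mul (by decide) hi, sum_digits_add_pow_mul (by decide) hi,
        sum_digits_of_lt (r := 1) (by decide) (by decide)]
    have hparity := odd_wt3_iff (i := i)
    rw [Nat.odd_iff, Nat.odd_iff] at hparity
    rw [hwt, Nat.ModEq]
    omega

lemma card_weightClass_lt (hm : 1 < m) {j : ℕ} (hj : Odd j) :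
    (weightClass m j).card < (3 ^ m - 1) / 2 := by
  have hS := isOddCosetUnion_weightClass m hj
  have hpow : 3 ^ 2 ≤ 3 ^ m := Nat.pow_le_pow_right (by decide) hm
  have hwt1 : wt3 1 = 1 := by simp [wt3]
  have hwt5 : wt3 5 = 3 := by simp [wt3]
  by_cases hj1 : 1 ≡ j [MOD 4]
  · refine hS.card_lt (i := 5) (by omega) (by decide) fun h5 => ?_
    rw [mem_weightClass, hwt5] at h5
    exact absurd (hj1.trans h5.2.symm) (by decide)
  · refine hS.card_lt (i := 1) (by omega) (by decide) fun h1 => hj1 ?_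
    rw [mem_weightClass, hwt1] at h1
    exact h1.2

lemma lt_minDist_fourthCode {h : ℕ} (hh : 0 < h) (hβ : IsPrimitiveRoot β (3 ^ (2 * h + 1) - 1))
    {r δ : ℕ} (hδ : r + 2 * δ ≤ 3 ^ h + 1) :
    δ < minDist (fourthCode (2 * h + 1) β (1 + 2 * r)) := by
  have hodd : Odd (1 + 2 * r) := odd_one.add_even (even_two_mul r)
  rw [← two_mul_three_pow_sub_one_div_two] at hβ
  rw [fourthCode_eq_cosetCode]
  refine lt_minDist_cosetCode hβ (isOddCosetUnion_weightClass _ hodd)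
    (card_weightClass_lt (by omega) hodd) (a := 3 ^ (2 * h) + r * (3 ^ h + 1))
    (coprime_three_pow_add_one h) fun t ht => ?_
  have hprogression : 3 ^ (2 * h) + r * (3 ^ h + 1) + 2 * (3 ^ h + 1) * t
      = 3 ^ (2 * h) + (r + 2 * t) * (3 ^ h + 1) := by ring
  have hmem := mem_weightClass.1 (bch_exponent_mem_weightClass (h := h) (i := r + 2 * t) (by omega))
  rw [hprogression, two_mul_three_pow_sub_one_div_two, Nat.mod_eq_of_lt hmem.1]
  refine mem_weightClass.2 ⟨hmem.1, hmem.2.trans ?_⟩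
  rw [Nat.ModEq]
  omega

lemma three_pow_add_three_le_two_mul_minDist_fourthCode_one {h : ℕ} (hh : 0 < h)
    (hβ : IsPrimitiveRoot β (3 ^ (2 * h + 1) - 1)) :
    3 ^ h + 3 ≤ 2 * minDist (fourthCode (2 * h + 1) β 1) := by
  obtain ⟨k, hk⟩ : Odd (3 ^ h) := Odd.pow (by decide)
  have hlt : k + 1 < minDist (fourthCode (2 * h + 1) β 1) :=
    lt_minDist_fourthCode hh hβ (r := 0) (by omega)
  omega

lemma three_pow_add_one_le_two_mul_minDist_fourthCode_three {h : ℕ} (hh : 0 < h)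
    (hβ : IsPrimitiveRoot β (3 ^ (2 * h + 1) - 1)) :
    3 ^ h + 1 ≤ 2 * minDist (fourthCode (2 * h + 1) β 3) := by
  obtain ⟨k, hk⟩ : Odd (3 ^ h) := Odd.pow (by decide)
  have hlt : k < minDist (fourthCode (2 * h + 1) β 3) :=
    lt_minDist_fourthCode hh hβ (r := 1) (by omega)
  omega

end FourthCode

lemma three_pow_add_two_add_div_four_add_three_le {h : ℕ} (hh : 2 ≤ h) :
    ((3 : ℚ) ^ h + 2 + (-1) ^ h) / 4 + 3 ≤ (3 ^ h + 3) / 2 := by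
  have hpow : (3 : ℚ) ^ 2 ≤ 3 ^ h := pow_le_pow_right₀ (by norm_num) hh
  rcases neg_one_pow_eq_or ℚ h with hsign | hsign <;> linarith

lemma three_pow_sub_div_four_add_two_le {h : ℕ} (hh : 2 ≤ h) :
    ((3 : ℚ) ^ h - (-1) ^ h) / 4 + 2 ≤ (3 ^ h + 1) / 2 := by
  have hpow : (3 : ℚ) ^ 2 ≤ 3 ^ h := pow_le_pow_right₀ (by norm_num) hh
  rcases neg_one_pow_eq_or ℚ h with hsign | hsign <;> linarith

end TernaryNegacyclic

theorem mainTheorem6_general {K : Type*} [Field K] [Algebra (ZMod 3) K] (m : ℕ) (hm : 1 < m)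
    (hodd : Odd m) (β : K) (hβ : IsPrimitiveRoot β (3 ^ m - 1)) :
    (Module.finrank (ZMod 3) (TernaryNegacyclic.fourthCode m β 1) : ℚ)
        = (3 ^ m - 1 + 2 * (-1) ^ ((m + 1) / 2)) / 4 ∧
    (TernaryNegacyclic.minDist (TernaryNegacyclic.fourthCode m β 1) : ℚ)
        ≥ (3 ^ ((m - 1) / 2) + 3) / 2 ∧
    TernaryNegacyclic.dualCode (TernaryNegacyclic.fourthCode m β 1)
        = TernaryNegacyclic.fourthCode m β 3 ∧
    (Module.finrank (ZMod 3)
        (TernaryNegacyclic.dualCode (TernaryNegacyclic.fourthCode m β 1)) : ℚ)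
        = (3 ^ m - 1 + 2 * (-1) ^ ((m - 1) / 2)) / 4 ∧
    (TernaryNegacyclic.minDist
        (TernaryNegacyclic.dualCode (TernaryNegacyclic.fourthCode m β 1)) : ℚ)
        ≥ (3 ^ ((m - 1) / 2) + 1) / 2 := by
  have hdual := TernaryNegacyclic.dualCode_fourthCode_one hodd hβ
  have hdim_one := TernaryNegacyclic.finrank_fourthCode_one hodd hβ
  have hdim_three := TernaryNegacyclic.finrank_fourthCode_three hodd hβ
  obtain ⟨h, rfl⟩ := hodd
  have hh : 0 < h := by omega
  obtain ⟨hcard_one, hcard_three⟩ := TernaryNegacyclic.card_weightClass_one_and_three h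
  have hdist_one := TernaryNegacyclic.three_pow_add_three_le_two_mul_minDist_fourthCode_one hh hβ
  have hdist_three := TernaryNegacyclic.three_pow_add_one_le_two_mul_minDist_fourthCode_three hh hβ
  rw [hdual, hdim_one, hdim_three, hcard_one, hcard_three,
    show (2 * h + 1 - 1) / 2 = h by omega, show (2 * h + 1 + 1) / 2 = h + 1 by omega]
  refine ⟨by ring, ?_, rfl, rfl, ?_⟩ <;> rw [ge_iff_le, div_le_iff₀' two_pos]
  · exact_mod_cast hdist_one
  · exact_mod_cast hdist_three

theorem mainTheorem6 {K : Type*} [Field K] [Algebra (ZMod 3) K] (m : ℕ) (hm : 5 ≤ m)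
    (hodd : Odd m) (hK : Nat.card K = 3 ^ m) (β : K) (hβ : IsPrimitiveRoot β (3 ^ m - 1)) :
    (Module.finrank (ZMod 3) (TernaryNegacyclic.fourthCode m β 1) : ℚ)
        = (3 ^ m - 1 + 2 * (-1) ^ ((m + 1) / 2)) / 4 ∧
    (TernaryNegacyclic.minDist (TernaryNegacyclic.fourthCode m β 1) : ℚ)
        ≥ (3 ^ ((m - 1) / 2) + 2 + (-1) ^ ((m - 1) / 2)) / 4 + 3 ∧
    TernaryNegacyclic.dualCode (TernaryNegacyclic.fourthCode m β 1)
        = TernaryNegacyclic.fourthCode m β 3 ∧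
    (Module.finrank (ZMod 3)
        (TernaryNegacyclic.dualCode (TernaryNegacyclic.fourthCode m β 1)) : ℚ)
        = (3 ^ m - 1 + 2 * (-1) ^ ((m - 1) / 2)) / 4 ∧
    (TernaryNegacyclic.minDist
        (TernaryNegacyclic.dualCode (TernaryNegacyclic.fourthCode m β 1)) : ℚ)
        ≥ (3 ^ ((m - 1) / 2) - (-1) ^ ((m - 1) / 2)) / 4 + 2 := by
  obtain ⟨hdim, hdist, hdual, hdim_dual, hdist_dual⟩ :=
    mainTheorem6_general m (by omega) hodd β hβ
  have hh : 2 ≤ (m - 1) / 2 := by omega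
  exact ⟨hdim, (TernaryNegacyclic.three_pow_add_two_add_div_four_add_three_le hh).trans hdist,
    hdual, hdim_dual, (TernaryNegacyclic.three_pow_sub_div_four_add_two_le hh).trans hdist_dual⟩
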